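/- Let $n\ge 0$ be an integer and $H\in M(n,\mathbb{R})$, and put $D=H-\tfrac12 I$. For $z>0$ and a real matrix $M$ let $z^M=\exp((\log z)M)$, and let $0^M=0$; let $x_+=\max\{x,0\}$, $x_-=\max\{-x,0\}$. Processes are indexed by $\mathbb{R}$, $\overset{\mathcal L}{=}$ denotes equality of finite-dimensional distributions, $*$ denotes the (conjugate) transpose and $\overline{A}$ the entrywise complex conjugate. An operator fractional Brownian motion (OFBM) with exponent $H$ is a Gaussian process $\{B_H(t)\}_{t\in\mathbb{R}}$ in $\mathbb{R}^n$ which is continuous in law at every $t$, satisfies $\{B_H(ct)\}\overset{\mathcal L}{=}\{c^HB_H(t)\}$ for all $c>0$, has stationary increments (the law of $\{B_H(t+h)-B_H(h)\}_t$ does not depend on $h\in\mathbb{R}$), and is proper (for each $t\neq 0$, the distribution of $B_H(t)$ is not supported in a proper linear subspace of $\mathbb{R}^n$). Let $\widetilde B=\widetilde B_1+i\widetilde B_2$ be a centred $\mathbb{C}^n$-valued Gaussian random measure on $\mathbb{R}$, where $\widetilde B_1,\widetilde B_2$ are independent real Gaussian random measures with $\widetilde B_1(-dx)=\widetilde B_1(dx)$,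 $\widetilde B_2(-dx)=-\widetilde B_2(dx)$ and $E\,\widetilde B(dx)\widetilde B(dx)^*=dx\,I$, that is, $E\,\widetilde B(E)\widetilde B(F)^*=|E\cap F|\,I$ for Borel sets $E,F$ of finite Lebesgue measure. **Theorem.** Let $\{B_H(t)\}_{t\in\mathbb{R}}$ be an OFBM with exponent $H$ and spectral representation $$\{B_H(t)\}_{t\in\mathbb{R}}\overset{\mathcal L}{=}\left\{\int_{\mathbb{R}}\frac{e^{itx}-1}{ix}\left(x_+^{-D}A+x_-^{-D}\overline{A}\right)\widetilde B(dx)\right\}_{t\in\mathbb{R}},$$ where $A=A_1+iA_2$ with $A_1,A_2\in M(n,\mathbb{R})$, and where, for each $t$, the integrand is in $L^2(\mathbb{R})$ and the integral is the mean-square limit of the integrals of simple functions. Then $B_H$ is time-reversible, that is, $\{B_H(t)\}\overset{\mathcal L}{=}\{B_H(-t)\}$, if and only if $AA^*=\overline{AA^*}$; moreover, $AA^*=\overline{AA^*}$ holds if and only if $A_2A_1^*=A_1A_2^*$. -/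

import Mathlib

open MeasureTheory ProbabilityTheory Filter
open scoped Topology Matrix ENNReal

noncomputable section

namespace OFBM

/-- Equality of all finite-dimensional distributions of two stochastic processes, possibly
defined on different probability spaces. -/
def EqFDD {T Ω Ω' E : Type*} [MeasurableSpace Ω] [MeasurableSpace Ω'] [MeasurableSpace E]
    (X : T → Ω → E) (Y : T → Ω' → E) (P : Measure Ω) (P' : Measure Ω') : Prop :=
  ∀ I : Finset T,
    IdentDistrib (fun ω (t : I) ↦ X t ω) (fun ω (t : I) ↦ Y t ω) P P'

/-- The operator power `z ^ M = exp (log z • M)` of a number `z > 0`, with the convention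
`0 ^ M = 0`. It is only used for `z ≥ 0`. -/
def opPow {n : ℕ} (z : ℝ) (M : Matrix (Fin n) (Fin n) ℝ) : Matrix (Fin n) (Fin n) ℝ :=
  if z = 0 then 0 else NormedSpace.exp (Real.log z • M)

/-- `X` is an operator fractional Brownian motion in `ℝⁿ` with exponent `H`: a proper Gaussian
process, continuous in law, operator self-similar with exponent `H`, and with stationary
increments. Properness is required at the times `t ≠ 0` only (operator self-similar processes
typically vanish at `t = 0`). -/
structure IsOFBM {Ω : Type*} [MeasurableSpace Ω] {n : ℕ}
    (P : Measure Ω) [IsProbabilityMeasure P] (H : Matrix (Fin n) (Fin n) ℝ)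
    (X : ℝ → Ω → Fin n → ℝ) : Prop where
  gaussian : IsGaussianProcess X P
  continuous_in_law : ∀ t : ℝ, TendstoInDistribution X (𝓝 t) (X t) (fun _ ↦ P) P
  self_similar : ∀ c : ℝ, 0 < c →
    EqFDD (fun t ↦ X (c * t)) (fun t ω ↦ opPow c H *ᵥ X t ω) P P
  stationary_increments : ∀ h h' : ℝ,
    EqFDD (fun t ω ↦ X (t + h) ω - X h ω) (fun t ω ↦ X (t + h') ω - X h' ω) P P
  proper : ∀ t : ℝ, t ≠ 0 → ∀ V : Submodule ℝ (Fin n → ℝ), V ≠ ⊤ → ¬ ∀ᵐ ω ∂P, X t ω ∈ V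

/-- Time-reversibility: `{X(t)}` and `{X(-t)}` have the same finite-dimensional distributions. -/
def TimeReversible {Ω E : Type*} [MeasurableSpace Ω] [MeasurableSpace E]
    (P : Measure Ω) (X : ℝ → Ω → E) : Prop :=
  EqFDD X (fun t ↦ X (-t)) P P

/-- Borel subsets of the line of finite Lebesgue measure. -/
abbrev FiniteBorelSet : Type := {E : Set ℝ // MeasurableSet E ∧ volume E < ∞}

/-- The complex random measure `B₁(E) + i B₂(E)`. -/
def complexMeasure {Ω : Type*} {n : ℕ} (B₁ B₂ : Set ℝ → Ω → Fin n → ℝ)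
    (E : Set ℝ) (ω : Ω) : Fin n → ℂ :=
  fun j ↦ (B₁ E ω j : ℂ) + Complex.I * (B₂ E ω j : ℂ)

/-- `B̃ = B₁ + i B₂` is the `ℂⁿ`-valued Gaussian random measure on the line with
`B₁, B₂` real, centred, Gaussian, independent of each other, `B₁(-dx) = B₁(dx)`,
`B₂(-dx) = -B₂(dx)` and `E B̃(dx) B̃(dx)* = dx I`, that is, `E B̃(E) B̃(F)* = |E ∩ F| I`.
(Almost sure additivity, and countable additivity in mean square, follow from the last identity.)
Only the values on Borel sets of finite Lebesgue measure matter. -/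
structure IsHermitianGaussianMeasure {Ω : Type*} [MeasurableSpace Ω] {n : ℕ}
    (P : Measure Ω) (B₁ B₂ : Set ℝ → Ω → Fin n → ℝ) : Prop where
  measurable_re : ∀ E : FiniteBorelSet, Measurable (B₁ E)
  measurable_im : ∀ E : FiniteBorelSet, Measurable (B₂ E)
  gaussian_re : IsGaussianProcess (fun E : FiniteBorelSet ↦ B₁ E) P
  gaussian_im : IsGaussianProcess (fun E : FiniteBorelSet ↦ B₂ E) P
  centred_re : ∀ (E : FiniteBorelSet) (j : Fin n), ∫ ω, B₁ E ω j ∂P = 0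
  centred_im : ∀ (E : FiniteBorelSet) (j : Fin n), ∫ ω, B₂ E ω j ∂P = 0
  indep : IndepFun (fun ω (E : FiniteBorelSet) ↦ B₁ E ω) (fun ω (E : FiniteBorelSet) ↦ B₂ E ω) P
  even_re : ∀ E : FiniteBorelSet, B₁ ((fun x ↦ -x) ⁻¹' (E : Set ℝ)) =ᵐ[P] B₁ E
  odd_im : ∀ E : FiniteBorelSet,
    B₂ ((fun x ↦ -x) ⁻¹' (E : Set ℝ)) =ᵐ[P] fun ω ↦ -B₂ E ω
  covariance : ∀ (E F : FiniteBorelSet) (j k : Fin n),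
    ∫ ω, complexMeasure B₁ B₂ E ω j * star (complexMeasure B₁ B₂ F ω k) ∂P
      = if j = k then ((volume.real ((E : Set ℝ) ∩ (F : Set ℝ)) : ℝ) : ℂ) else 0

/-- The stochastic integral `∑ y B̃(s⁻¹{y})` of a matrix-valued simple function `s`. -/
def simpleIntegral {Ω : Type*} {n : ℕ} (B : Set ℝ → Ω → Fin n → ℂ)
    (s : SimpleFunc ℝ (Matrix (Fin n) (Fin n) ℂ)) (ω : Ω) : Fin n → ℂ :=
  ∑ y ∈ s.range, y *ᵥ B (s ⁻¹' {y}) ω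

/-- The random vector `Y` is (a version of) the stochastic integral `∫ f(x) B(dx)`: the matrix
function `f` is in `L²(ℝ)` and, for some simple functions of finite measure support converging to
`f` in `L²(ℝ)`, the integrals of the simple functions converge to `Y` in `L²(P)`. -/
def IsStochasticIntegral {Ω : Type*} [MeasurableSpace Ω] {n : ℕ} (P : Measure Ω)
    (B : Set ℝ → Ω → Fin n → ℂ) (f : ℝ → Matrix (Fin n) (Fin n) ℂ) (Y : Ω → Fin n → ℂ) : Prop :=
  (∀ j k, MemLp (fun x ↦ f x j k) 2 volume) ∧ (∀ j, MemLp (fun ω ↦ Y ω j) 2 P) ∧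
  ∃ s : ℕ → SimpleFunc ℝ (Matrix (Fin n) (Fin n) ℂ),
    (∀ m, (s m).FinMeasSupp volume) ∧
    (∀ j k, Tendsto (fun m ↦ eLpNorm (fun x ↦ s m x j k - f x j k) 2 volume) atTop (𝓝 0)) ∧
    (∀ j, Tendsto (fun m ↦ eLpNorm (fun ω ↦ simpleIntegral B (s m) ω j - Y ω j) 2 P)
      atTop (𝓝 0))

/-- The kernel `((e^{itx} - 1) / (ix)) (x₊^{-D} A + x₋^{-D} Ā)` with `D = H - (1/2) I`. -/
def spectralKernel {n : ℕ} (H : Matrix (Fin n) (Fin n) ℝ) (A : Matrix (Fin n) (Fin n) ℂ)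
    (t x : ℝ) : Matrix (Fin n) (Fin n) ℂ :=
  ((Complex.exp (Complex.I * t * x) - 1) / (Complex.I * x)) •
    ((opPow (max x 0) (-(H - (1 / 2 : ℝ) • 1))).map Complex.ofReal * A
      + (opPow (max (-x) 0) (-(H - (1 / 2 : ℝ) • 1))).map Complex.ofReal * A.map star)

/-- `X` has the spectral representation
`{X(t)} = {∫ ((e^{itx} - 1) / (ix)) (x₊^{-D} A + x₋^{-D} Ā) B̃(dx)}` (equality of
finite-dimensional distributions) in terms of the random measure `B̃ = B₁ + i B₂`, which may live
on another probability space. -/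
def HasSpectralRepresentation {Ω Ω' : Type*} [MeasurableSpace Ω] [MeasurableSpace Ω'] {n : ℕ}
    (P : Measure Ω) (P' : Measure Ω') (H : Matrix (Fin n) (Fin n) ℝ)
    (A : Matrix (Fin n) (Fin n) ℂ) (B₁ B₂ : Set ℝ → Ω' → Fin n → ℝ)
    (X : ℝ → Ω → Fin n → ℝ) : Prop :=
  IsHermitianGaussianMeasure P' B₁ B₂ ∧
  ∃ Y : ℝ → Ω' → Fin n → ℂ,
    (∀ t, IsStochasticIntegral P' (complexMeasure B₁ B₂) (spectralKernel H A t) (Y t)) ∧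
    EqFDD (fun t ω j ↦ (X t ω j : ℂ)) Y P P'

end OFBM

end

namespace OFBM

/-! Write `k_t(x) = (e^{itx} - 1)/(ix)` and `S = F F*`, where `F` is the matrix factor of the
kernel. The Itô isometry gives `E X(s) X(t)ᵀ = ∫ k_s k̄_t S dx`
(`HasSpectralRepresentation.integral_mul`). Since `k_{-t} = -k̄_t` and covariances are real,
reversing time replaces `S` by `S̄`. The process is Gaussian and centred, so it is reversible iff `∫
k_s k̄_t Im S dx = 0` for all `s, t`. If `AA*` is real, so is `S`. Conversely, `k_{1+h} - k_h =
e^{ihx} k_1` turns the vanishing integrals into the Fourier transform of `|k_1|² Im S`, so `Im S =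
0` at some `x` in `(0, 1)`. There `S = x^{-D} AA* (x^{-D})ᵀ` with real invertible outer factors,
which forces `AA*` to be real. The second equivalence holds because `Im AA* = A₂A₁ᵀ - A₁A₂ᵀ`. -/

/-! ### Mean and covariance of stochastic integrals -/

theorem tendsto_integral_mul_star {α : Type*} [MeasurableSpace α] {μ : Measure α}
    {u v : ℕ → α → ℂ} {f g : α → ℂ}
    (hu : ∀ m, MemLp (u m) 2 μ) (hv : ∀ m, MemLp (v m) 2 μ) (hf : MemLp f 2 μ) (hg : MemLp g 2 μ)
    (huf : Tendsto (fun m ↦ eLpNorm (fun x ↦ u m x - f x) 2 μ) atTop (𝓝 0))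
    (hvg : Tendsto (fun m ↦ eLpNorm (fun x ↦ v m x - g x) 2 μ) atTop (𝓝 0)) :
    Tendsto (fun m ↦ ∫ x, u m x * star (v m x) ∂μ) atTop (𝓝 (∫ x, f x * star (g x) ∂μ)) := by
  have key : ∀ {a b : α → ℂ} (ha : MemLp a 2 μ) (hb : MemLp b 2 μ),
      inner ℂ (hb.toLp b) (ha.toLp a) = ∫ x, a x * star (b x) ∂μ := by
    intro a b ha hb
    rw [L2.inner_def]
    refine integral_congr_ae ?_
    filter_upwards [ha.coeFn_toLp, hb.coeFn_toLp] with x h₁ h₂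
    rw [h₁, h₂]
    simp
  have h₁ : Tendsto (fun m ↦ (hu m).toLp (u m)) atTop (𝓝 (hf.toLp f)) :=
    (Lp.tendsto_Lp_iff_tendsto_eLpNorm'' _ hu _ hf).2 huf
  have h₂ : Tendsto (fun m ↦ (hv m).toLp (v m)) atTop (𝓝 (hg.toLp g)) :=
    (Lp.tendsto_Lp_iff_tendsto_eLpNorm'' _ hv _ hg).2 hvg
  simpa only [key] using h₂.inner (𝕜 := ℂ) h₁

section HermitianGaussianMeasure

variable {Ω : Type*} [MeasurableSpace Ω] {n : ℕ} {P : Measure Ω} {B₁ B₂ : Set ℝ → Ω → Fin n → ℝ}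

theorem IsHermitianGaussianMeasure.memLp (hB : IsHermitianGaussianMeasure P B₁ B₂)
    (E : FiniteBorelSet) (j : Fin n) : MemLp (fun ω ↦ complexMeasure B₁ B₂ E ω j) 2 P := by
  have h₁ : MemLp (fun ω ↦ B₁ E ω j) 2 P :=
    ((hB.gaussian_re.hasGaussianLaw_eval E).eval j).memLp_two
  have h₂ : MemLp (fun ω ↦ B₂ E ω j) 2 P :=
    ((hB.gaussian_im.hasGaussianLaw_eval E).eval j).memLp_two
  have h₃ : MemLp (fun ω ↦ (B₁ E ω j : ℂ)) 2 P := h₁.ofReal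
  have h₄ : MemLp (fun ω ↦ (B₂ E ω j : ℂ)) 2 P := h₂.ofReal
  simp only [complexMeasure]
  exact h₃.add (h₄.const_mul Complex.I)

theorem IsHermitianGaussianMeasure.integral_eq_zero (hB : IsHermitianGaussianMeasure P B₁ B₂)
    (E : FiniteBorelSet) (j : Fin n) : ∫ ω, complexMeasure B₁ B₂ E ω j ∂P = 0 := by
  have h₁ : Integrable (fun ω ↦ B₁ E ω j) P :=
    ((hB.gaussian_re.hasGaussianLaw_eval E).eval j).integrable
  have h₂ : Integrable (fun ω ↦ B₂ E ω j) P :=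
    ((hB.gaussian_im.hasGaussianLaw_eval E).eval j).integrable
  simp only [complexMeasure]
  rw [integral_add h₁.ofReal (h₂.ofReal.const_mul _), integral_const_mul, integral_complex_ofReal,
    integral_complex_ofReal, hB.centred_re, hB.centred_im]
  simp

/-- The level set of a simple function of finite measure support at `y`, replaced by `∅` at `y = 0`. -/
noncomputable def levelSet (s : SimpleFunc ℝ (Matrix (Fin n) (Fin n) ℂ)) (hs : s.FinMeasSupp volume)
    (y : Matrix (Fin n) (Fin n) ℂ) : FiniteBorelSet :=
  if hy : y = 0 then ⟨∅, by simp⟩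
  else ⟨s ⁻¹' {y}, s.measurableSet_fiber y, hs.meas_preimage_singleton_ne_zero hy⟩

-- The fibre over `0` may have infinite measure, where nothing is known about the random measure.
-- Its coefficient is `y = 0`, so any set of finite measure can stand in for it.
omit [MeasurableSpace Ω] in
theorem simpleIntegral_eq (B : Set ℝ → Ω → Fin n → ℂ)
    (s : SimpleFunc ℝ (Matrix (Fin n) (Fin n) ℂ)) (hs : s.FinMeasSupp volume)
    (ω : Ω) (j : Fin n) :
    simpleIntegral B s ω j =
      ∑ y ∈ s.range, ∑ l, y j l * B (levelSet s hs y : Set ℝ) ω l := by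
  simp only [simpleIntegral, Finset.sum_apply, Matrix.mulVec, dotProduct]
  refine Finset.sum_congr rfl fun y _ ↦ ?_
  by_cases hy : y = 0
  · simp [hy]
  · simp [levelSet, hy]

theorem simpleFunc_apply_eq (s : SimpleFunc ℝ (Matrix (Fin n) (Fin n) ℂ))
    (hs : s.FinMeasSupp volume) (x : ℝ) (j l : Fin n) :
    s x j l = ∑ y ∈ s.range, y j l * (levelSet s hs y : Set ℝ).indicator (fun _ ↦ (1 : ℂ)) x := by
  rw [Finset.sum_eq_single (s x)]
  · by_cases h : s x = 0
    · simp [h]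
    · simp [levelSet, h]
  · intro y _ hy
    by_cases h : y = 0
    · simp [h]
    · simp [levelSet, h, Set.indicator, Ne.symm hy]
  · intro h
    exact absurd (s.mem_range_self x) h

theorem memLp_simpleFunc_apply (s : SimpleFunc ℝ (Matrix (Fin n) (Fin n) ℂ))
    (hs : s.FinMeasSupp volume) (j l : Fin n) : MemLp (fun x ↦ s x j l) 2 volume := by
  simp_rw [simpleFunc_apply_eq s hs]
  exact memLp_finsetSum _ fun y _ ↦ (memLp_indicator_const 2 (levelSet s hs y).2.1 (1 : ℂ)
    (Or.inr (levelSet s hs y).2.2.ne)).const_mul _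

theorem IsHermitianGaussianMeasure.memLp_simpleIntegral
    (hB : IsHermitianGaussianMeasure P B₁ B₂)
    (s : SimpleFunc ℝ (Matrix (Fin n) (Fin n) ℂ)) (hs : s.FinMeasSupp volume) (j : Fin n) :
    MemLp (fun ω ↦ simpleIntegral (complexMeasure B₁ B₂) s ω j) 2 P := by
  simp_rw [simpleIntegral_eq _ s hs]
  exact memLp_finsetSum _ fun y _ ↦ memLp_finsetSum _ fun l _ ↦ (hB.memLp _ l).const_mul _

theorem IsHermitianGaussianMeasure.integral_simpleIntegral [IsProbabilityMeasure P]
    (hB : IsHermitianGaussianMeasure P B₁ B₂)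
    (s : SimpleFunc ℝ (Matrix (Fin n) (Fin n) ℂ)) (hs : s.FinMeasSupp volume) (j : Fin n) :
    ∫ ω, simpleIntegral (complexMeasure B₁ B₂) s ω j ∂P = 0 := by
  simp_rw [simpleIntegral_eq _ s hs]
  have hi : ∀ (y : Matrix (Fin n) (Fin n) ℂ) (l : Fin n),
      Integrable (fun ω ↦ y j l * complexMeasure B₁ B₂ (levelSet s hs y : Set ℝ) ω l) P :=
    fun y l ↦ ((hB.memLp _ l).integrable one_le_two).const_mul _
  rw [integral_finsetSum _ fun y _ ↦ integrable_finsetSum _ fun l _ ↦ hi y l]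
  refine Finset.sum_eq_zero fun y _ ↦ ?_
  rw [integral_finsetSum _ fun l _ ↦ hi y l]
  refine Finset.sum_eq_zero fun l _ ↦ ?_
  rw [integral_const_mul, hB.integral_eq_zero, mul_zero]

/-- The Itô isometry for simple functions. -/
theorem IsHermitianGaussianMeasure.integral_simpleIntegral_mul_star
    (hB : IsHermitianGaussianMeasure P B₁ B₂)
    (s r : SimpleFunc ℝ (Matrix (Fin n) (Fin n) ℂ)) (hs : s.FinMeasSupp volume)
    (hr : r.FinMeasSupp volume) (j k : Fin n) :
    ∫ ω, simpleIntegral (complexMeasure B₁ B₂) s ω j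
        * star (simpleIntegral (complexMeasure B₁ B₂) r ω k) ∂P
      = ∑ l, ∫ x, s x j l * star (r x k l) := by
  have hP : ∀ (E F : FiniteBorelSet) (l m : Fin n) (a b : ℂ),
      Integrable (fun ω ↦ a * complexMeasure B₁ B₂ E ω l
        * star (b * complexMeasure B₁ B₂ F ω m)) P := fun E F l m a b ↦
    ((hB.memLp E l).const_mul a).integrable_mul ((hB.memLp F m).const_mul b).star
  have hV : ∀ (E F : FiniteBorelSet) (a b : ℂ),
      Integrable (fun x ↦ a * (E : Set ℝ).indicator (fun _ ↦ (1 : ℂ)) x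
        * star (b * (F : Set ℝ).indicator (fun _ ↦ (1 : ℂ)) x)) volume := fun E F a b ↦
    ((memLp_indicator_const 2 E.2.1 (1 : ℂ) (Or.inr E.2.2.ne)).const_mul a).integrable_mul
      ((memLp_indicator_const 2 F.2.1 (1 : ℂ) (Or.inr F.2.2.ne)).const_mul b).star
  have eP : ∀ (E F : FiniteBorelSet) (l m : Fin n) (a b : ℂ),
      ∫ ω, a * complexMeasure B₁ B₂ E ω l * star (b * complexMeasure B₁ B₂ F ω m) ∂P
        = if l = m then a * star b * volume.real ((E : Set ℝ) ∩ F) else 0 := by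
    intro E F l m a b
    have : ∀ ω, a * complexMeasure B₁ B₂ E ω l * star (b * complexMeasure B₁ B₂ F ω m)
        = a * star b * (complexMeasure B₁ B₂ E ω l * star (complexMeasure B₁ B₂ F ω m)) := by
      intro ω; rw [star_mul']; ring
    simp_rw [this]
    rw [integral_const_mul, hB.covariance]
    split_ifs <;> simp
  have eV : ∀ (E F : FiniteBorelSet) (a b : ℂ),
      ∫ x, a * (E : Set ℝ).indicator (fun _ ↦ (1 : ℂ)) x
        * star (b * (F : Set ℝ).indicator (fun _ ↦ (1 : ℂ)) x)
        = a * star b * volume.real ((E : Set ℝ) ∩ F) := by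
    intro E F a b
    have : ∀ x, a * (E : Set ℝ).indicator (fun _ ↦ (1 : ℂ)) x
        * star (b * (F : Set ℝ).indicator (fun _ ↦ (1 : ℂ)) x)
        = a * star b * ((E : Set ℝ) ∩ F).indicator (fun _ ↦ (1 : ℂ)) x := by
      intro x
      by_cases h₁ : x ∈ (E : Set ℝ) <;> by_cases h₂ : x ∈ (F : Set ℝ) <;> simp [h₁, h₂]
    simp_rw [this]
    rw [integral_const_mul, integral_indicator (E.2.1.inter F.2.1)]
    simp
  simp_rw [simpleIntegral_eq _ s hs, simpleIntegral_eq _ r hr, simpleFunc_apply_eq s hs,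
    simpleFunc_apply_eq r hr, star_sum, Finset.sum_mul_sum]
  have e₁ : ∀ l, ∫ x, ∑ y ∈ s.range, ∑ z ∈ r.range,
      y j l * (levelSet s hs y : Set ℝ).indicator (fun _ ↦ (1 : ℂ)) x
        * star (z k l * (levelSet r hr z : Set ℝ).indicator (fun _ ↦ (1 : ℂ)) x)
      = ∑ y ∈ s.range, ∑ z ∈ r.range, y j l * star (z k l)
        * volume.real ((levelSet s hs y : Set ℝ) ∩ levelSet r hr z) := by
    intro l
    rw [integral_finsetSum _ fun y _ ↦ integrable_finsetSum _ fun z _ ↦ hV _ _ _ _]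
    refine Finset.sum_congr rfl fun y _ ↦ ?_
    rw [integral_finsetSum _ fun z _ ↦ hV _ _ _ _]
    exact Finset.sum_congr rfl fun z _ ↦ eV _ _ _ _
  simp_rw [e₁]
  rw [integral_finsetSum _ fun y _ ↦ integrable_finsetSum _ fun z _ ↦ integrable_finsetSum _
    fun l _ ↦ integrable_finsetSum _ fun m _ ↦ hP _ _ _ _ _ _]
  rw [Finset.sum_comm]
  refine Finset.sum_congr rfl fun y _ ↦ ?_
  rw [integral_finsetSum _ fun z _ ↦ integrable_finsetSum _
    fun l _ ↦ integrable_finsetSum _ fun m _ ↦ hP _ _ _ _ _ _]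
  rw [Finset.sum_comm]
  refine Finset.sum_congr rfl fun z _ ↦ ?_
  rw [integral_finsetSum _ fun l _ ↦ integrable_finsetSum _ fun m _ ↦ hP _ _ _ _ _ _]
  refine Finset.sum_congr rfl fun l _ ↦ ?_
  rw [integral_finsetSum _ fun m _ ↦ hP _ _ _ _ _ _]
  -- Distinct components of the noise are uncorrelated, so only the terms `m = l` survive.
  simp_rw [eP]
  simp

theorem IsStochasticIntegral.integral_mul_star (hB : IsHermitianGaussianMeasure P B₁ B₂)
    {f g : ℝ → Matrix (Fin n) (Fin n) ℂ} {Y Z : Ω → Fin n → ℂ}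
    (hY : IsStochasticIntegral P (complexMeasure B₁ B₂) f Y)
    (hZ : IsStochasticIntegral P (complexMeasure B₁ B₂) g Z) (j k : Fin n) :
    ∫ ω, Y ω j * star (Z ω k) ∂P = ∑ l, ∫ x, f x j l * star (g x k l) := by
  obtain ⟨hf, hY2, s, hs, hsf, hsY⟩ := hY
  obtain ⟨hg, hZ2, r, hr, hrg, hrZ⟩ := hZ
  have h₁ := tendsto_integral_mul_star (fun m ↦ hB.memLp_simpleIntegral (s m) (hs m) j)
    (fun m ↦ hB.memLp_simpleIntegral (r m) (hr m) k) (hY2 j) (hZ2 k) (hsY j) (hrZ k)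
  have h₂ := tendsto_finsetSum Finset.univ fun l _ ↦ tendsto_integral_mul_star
    (fun m ↦ memLp_simpleFunc_apply (s m) (hs m) j l)
    (fun m ↦ memLp_simpleFunc_apply (r m) (hr m) k l) (hf j l) (hg k l) (hsf j l) (hrg k l)
  simp_rw [hB.integral_simpleIntegral_mul_star _ _ (hs _) (hr _)] at h₁
  exact tendsto_nhds_unique h₁ h₂

theorem IsStochasticIntegral.integral_eq_zero [IsProbabilityMeasure P]
    (hB : IsHermitianGaussianMeasure P B₁ B₂)
    {f : ℝ → Matrix (Fin n) (Fin n) ℂ} {Y : Ω → Fin n → ℂ}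
    (hY : IsStochasticIntegral P (complexMeasure B₁ B₂) f Y) (j : Fin n) :
    ∫ ω, Y ω j ∂P = 0 := by
  obtain ⟨-, hY2, s, hs, -, hsY⟩ := hY
  -- Pairing with the constant `1` turns the inner product into a mean.
  have h₁ := tendsto_integral_mul_star (fun m ↦ hB.memLp_simpleIntegral (s m) (hs m) j)
    (fun _ ↦ memLp_const (1 : ℂ)) (hY2 j) (memLp_const (1 : ℂ)) (hsY j) (by simp)
  simp_rw [star_one, mul_one, hB.integral_simpleIntegral _ (hs _)] at h₁
  exact tendsto_nhds_unique h₁ tendsto_const_nhds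

end HermitianGaussianMeasure

/-! ### Uniqueness for Fourier transforms of integrable functions -/

/-- An integrable real function with vanishing Fourier transform vanishes almost everywhere. -/
theorem ae_eq_zero_of_integral_exp_mul_eq_zero {v : ℝ → ℝ} (hv : Integrable v)
    (h : ∀ t : ℝ, ∫ x : ℝ, Complex.exp (t * x * Complex.I) * (v x : ℂ) = 0) : v =ᵐ[volume] 0 := by
  -- `ENNReal.ofReal` truncates at zero, so `v` and `-v` yield finite measures with densities `v⁺`
  -- and `v⁻`. The hypothesis says that their characteristic functions agree.
  have hfin : ∀ {u : ℝ → ℝ}, Integrable u →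
      IsFiniteMeasure (volume.withDensity fun x ↦ ENNReal.ofReal (u x)) :=
    fun hu ↦ isFiniteMeasure_withDensity_ofReal hu.2
  have hchar : ∀ {u : ℝ → ℝ}, Integrable u → ∀ t : ℝ,
      charFun (volume.withDensity fun x ↦ ENNReal.ofReal (u x)) t
        = ∫ x : ℝ, Complex.exp (t * x * Complex.I) * ((max (u x) 0 : ℝ) : ℂ) := by
    intro u hu t
    rw [charFun_apply_real, integral_withDensity_eq_integral_toReal_smul₀
      hu.aemeasurable.ennreal_ofReal (by simp)]
    refine integral_congr_ae (Eventually.of_forall fun x ↦ ?_)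
    simp only [ENNReal.toReal_ofReal', Complex.real_smul]
    ring
  have hint : ∀ {u : ℝ → ℝ}, Integrable u → ∀ t : ℝ,
      Integrable fun x : ℝ ↦ Complex.exp (t * x * Complex.I) * ((max (u x) 0 : ℝ) : ℂ) := by
    intro u hu t
    refine (hu.pos_part.ofReal (𝕜 := ℂ)).bdd_mul (c := 1) (by fun_prop) ?_
    refine Eventually.of_forall fun x ↦ ?_
    rw [← Complex.ofReal_mul, Complex.norm_exp_ofReal_mul_I]
  have := hfin hv
  have := hfin hv.neg
  have heq : (volume.withDensity fun x ↦ ENNReal.ofReal (v x))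
      = volume.withDensity fun x ↦ ENNReal.ofReal ((-v) x) := by
    refine Measure.ext_of_charFun (funext fun t ↦ ?_)
    rw [hchar hv, hchar hv.neg, ← sub_eq_zero, ← integral_sub (hint hv t) (hint hv.neg t), ← h t]
    refine integral_congr_ae (Eventually.of_forall fun x ↦ ?_)
    simp only [← mul_sub, ← Complex.ofReal_sub, Pi.neg_apply]
    congr 2
    rcases le_total (v x) 0 with h | h <;> simp [h]
  have hae := (withDensity_eq_iff hv.aemeasurable.ennreal_ofReal
    hv.neg.aemeasurable.ennreal_ofReal hv.lintegral_lt_top.ne).1 heq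
  -- Now `v⁺ = v⁻` almost everywhere, and one of the two is always zero.
  filter_upwards [hae] with x hx
  rcases le_total (v x) 0 with h | h
  · rw [ENNReal.ofReal_of_nonpos h] at hx
    have := ENNReal.ofReal_eq_zero.1 hx.symm
    simp only [Pi.neg_apply, Pi.zero_apply] at this ⊢
    linarith
  · rw [ENNReal.ofReal_of_nonpos (show (-v) x ≤ 0 by simpa using h)] at hx
    exact le_antisymm (ENNReal.ofReal_eq_zero.1 hx) h

/-! ### Centred Gaussian processes are determined by their covariances -/

theorem integral_sum_mul_eq_zero_of_centred {T Ω : Type*} [MeasurableSpace Ω] {n : ℕ}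
    {P : Measure Ω} {X : T → Ω → Fin n → ℝ} (hX : IsGaussianProcess X P)
    (h0 : ∀ t j, ∫ ω, X t ω j ∂P = 0) {I : Finset T} (a : I → Fin n → ℝ) :
    ∫ ω, ∑ t, ∑ j, a t j * X t ω j ∂P = 0 := by
  have hi : ∀ (t : I) j, Integrable (fun ω ↦ a t j * X t ω j) P := fun t j ↦
    ((hX.hasGaussianLaw_eval t).eval j).integrable.const_mul _
  rw [integral_finsetSum _ fun t _ ↦ integrable_finsetSum _ fun j _ ↦ hi t j]
  refine Finset.sum_eq_zero fun t _ ↦ ?_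
  rw [integral_finsetSum _ fun j _ ↦ hi t j]
  refine Finset.sum_eq_zero fun j _ ↦ ?_
  rw [integral_const_mul, h0, mul_zero]

theorem variance_sum_mul_of_centred {T Ω : Type*} [MeasurableSpace Ω] {n : ℕ}
    {P : Measure Ω} {X : T → Ω → Fin n → ℝ} (hX : IsGaussianProcess X P)
    (h0 : ∀ t j, ∫ ω, X t ω j ∂P = 0) {I : Finset T} (a : I → Fin n → ℝ) :
    Var[fun ω ↦ ∑ t, ∑ j, a t j * X t ω j; P]
      = ∑ s, ∑ t, ∑ j, ∑ k, a s j * a t k * ∫ ω, X s ω j * X t ω k ∂P := by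
  have hL : ∀ (t : I) j, MemLp (fun ω ↦ X t ω j) 2 P := fun t j ↦
    ((hX.hasGaussianLaw_eval t).eval j).memLp_two
  have hi : ∀ (s t : I) j k, Integrable (fun ω ↦ a s j * a t k * (X s ω j * X t ω k)) P :=
    fun s t j k ↦ ((hL s j).integrable_mul (hL t k)).const_mul _
  rw [variance_of_integral_eq_zero _ (integral_sum_mul_eq_zero_of_centred hX h0 a)]
  · have : ∀ ω, (∑ t : I, ∑ j, a t j * X t ω j) ^ 2
        = ∑ s : I, ∑ t : I, ∑ j, ∑ k, a s j * a t k * (X s ω j * X t ω k) := by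
      intro ω
      simp_rw [sq, Finset.sum_mul_sum]
      refine Finset.sum_congr rfl fun s _ ↦ Finset.sum_congr rfl fun t _ ↦
        Finset.sum_congr rfl fun j _ ↦ Finset.sum_congr rfl fun k _ ↦ by ring
    simp_rw [this]
    rw [integral_finsetSum _ fun s _ ↦ integrable_finsetSum _ fun t _ ↦ integrable_finsetSum _
      fun j _ ↦ integrable_finsetSum _ fun k _ ↦ hi s t j k]
    refine Finset.sum_congr rfl fun s _ ↦ ?_
    rw [integral_finsetSum _ fun t _ ↦ integrable_finsetSum _
      fun j _ ↦ integrable_finsetSum _ fun k _ ↦ hi s t j k]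
    refine Finset.sum_congr rfl fun t _ ↦ ?_
    rw [integral_finsetSum _ fun j _ ↦ integrable_finsetSum _ fun k _ ↦ hi s t j k]
    refine Finset.sum_congr rfl fun j _ ↦ ?_
    rw [integral_finsetSum _ fun k _ ↦ hi s t j k]
    exact Finset.sum_congr rfl fun k _ ↦ integral_const_mul _ _
  · exact (memLp_finsetSum _ fun t _ ↦ memLp_finsetSum _ fun j _ ↦
      (hL t j).const_mul (a t j)).aestronglyMeasurable.aemeasurable

/-- Two centred Gaussian processes with the same covariance have the same finite-dimensional
distributions. -/
theorem eqFDD_of_integral_mul_eq {T Ω Ω' : Type*} [MeasurableSpace Ω] [MeasurableSpace Ω']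
    {n : ℕ} {P : Measure Ω} {P' : Measure Ω'} {X : T → Ω → Fin n → ℝ} {Y : T → Ω' → Fin n → ℝ}
    (hX : IsGaussianProcess X P) (hY : IsGaussianProcess Y P')
    (hX0 : ∀ t j, ∫ ω, X t ω j ∂P = 0) (hY0 : ∀ t j, ∫ ω, Y t ω j ∂P' = 0)
    (hcov : ∀ s t j k, ∫ ω, X s ω j * X t ω k ∂P = ∫ ω, Y s ω j * Y t ω k ∂P') :
    EqFDD X Y P P' := by
  classical
  intro I
  have hXI : HasGaussianLaw (fun ω (t : I) ↦ X t ω) P := hX.hasGaussianLaw I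
  have hYI : HasGaussianLaw (fun ω (t : I) ↦ Y t ω) P' := hY.hasGaussianLaw I
  refine ⟨hXI.aemeasurable, hYI.aemeasurable, ?_⟩
  have := hXI.isGaussian_map
  have := hYI.isGaussian_map
  -- Every functional `L` is a combination of coordinates, and a Gaussian characteristic function
  -- sees only its mean (zero) and its variance, a quadratic form in the covariances.
  refine Measure.ext_of_charFunDual (funext fun L ↦ ?_)
  have hL : ∀ x : I → Fin n → ℝ,
      L x = ∑ t, ∑ j, L (Pi.single t (Pi.single j 1)) * x t j := by
    intro x
    conv_lhs => rw [show x = ∑ t, ∑ j, x t j • Pi.single t (Pi.single j (1 : ℝ)) by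
      ext t j
      simp [Finset.sum_apply, Pi.single_apply, Finset.sum_ite_eq, ite_apply]]
    simp_rw [map_sum, map_smul, smul_eq_mul, mul_comm]
  rw [hXI.charFunDual_map_eq_fun, hYI.charFunDual_map_eq_fun]
  have hLX : ∀ ω, L (fun t : I ↦ X t ω)
      = ∑ t : I, ∑ j, L (Pi.single t (Pi.single j 1)) * X t ω j := fun ω ↦ hL _
  have hLY : ∀ ω, L (fun t : I ↦ Y t ω)
      = ∑ t : I, ∑ j, L (Pi.single t (Pi.single j 1)) * Y t ω j := fun ω ↦ hL _
  simp only [hLX, hLY]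
  rw [integral_sum_mul_eq_zero_of_centred hX hX0, integral_sum_mul_eq_zero_of_centred hY hY0,
    variance_sum_mul_of_centred hX hX0, variance_sum_mul_of_centred hY hY0]
  simp_rw [hcov]

/-! ### The scalar kernel and the spectral density -/

/-- The Fourier transform of the indicator of `[0, t]`, up to normalization. -/
noncomputable def intervalKernel (t x : ℝ) : ℂ :=
  (Complex.exp (Complex.I * t * x) - 1) / (Complex.I * x)

/-- The sign cancels in products of two kernels, so reversing time amounts to conjugation. -/
theorem intervalKernel_neg (t x : ℝ) : intervalKernel (-t) x = -star (intervalKernel t x) := by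
  simp only [intervalKernel, Complex.star_def, map_div₀, map_sub, map_mul, ← Complex.exp_conj,
    Complex.conj_I, Complex.conj_ofReal, map_one, Complex.ofReal_neg, neg_mul, mul_neg, div_neg,
    neg_neg]

/-- Translating the interval `[0, s]` by `h` multiplies its Fourier transform by a character. This
is what brings a Fourier transform in `h` into the covariances. -/
theorem intervalKernel_add_sub (s h x : ℝ) :
    intervalKernel (s + h) x - intervalKernel h x
      = Complex.exp (h * x * Complex.I) * intervalKernel s x := by
  have : Complex.exp (Complex.I * (s + h : ℝ) * x)
      = Complex.exp (h * x * Complex.I) * Complex.exp (Complex.I * s * x) := by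
    rw [← Complex.exp_add]; congr 1; push_cast; ring
  have h' : Complex.exp (Complex.I * h * x) = Complex.exp (h * x * Complex.I) := by
    congr 1; ring
  rw [intervalKernel, intervalKernel, intervalKernel, this, h']
  ring

theorem intervalKernel_one_ne_zero {x : ℝ} (h0 : 0 < x) (h1 : x < 1) : intervalKernel 1 x ≠ 0 := by
  -- The numerator `e^{ix} - 1` has imaginary part `sin x`, positive since `1 < π`.
  have hs : Real.sin x ≠ 0 :=
    (Real.sin_pos_of_pos_of_lt_pi h0 (h1.trans (by linarith [Real.pi_gt_three]))).ne'
  refine div_ne_zero (fun h ↦ hs ?_) (mul_ne_zero Complex.I_ne_zero (by exact_mod_cast h0.ne'))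
  have := congrArg Complex.im h
  simpa [mul_comm Complex.I, Complex.exp_ofReal_mul_I_im] using this

variable {n : ℕ}

/-- The matrix factor `x₊^{-D} A + x₋^{-D} Ā` of the spectral kernel. -/
noncomputable def spectralFactor (H : Matrix (Fin n) (Fin n) ℝ) (A : Matrix (Fin n) (Fin n) ℂ)
    (x : ℝ) : Matrix (Fin n) (Fin n) ℂ :=
  (opPow (max x 0) (-(H - (1 / 2 : ℝ) • 1))).map Complex.ofReal * A
    + (opPow (max (-x) 0) (-(H - (1 / 2 : ℝ) • 1))).map Complex.ofReal * A.map star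

/-- The spectral density matrix of the noise driving the process. -/
noncomputable def spectralDensity (H : Matrix (Fin n) (Fin n) ℝ) (A : Matrix (Fin n) (Fin n) ℂ)
    (x : ℝ) : Matrix (Fin n) (Fin n) ℂ :=
  spectralFactor H A x * (spectralFactor H A x)ᴴ

theorem spectralKernel_apply (H : Matrix (Fin n) (Fin n) ℝ) (A : Matrix (Fin n) (Fin n) ℂ)
    (t x : ℝ) (j k : Fin n) :
    spectralKernel H A t x j k = intervalKernel t x * spectralFactor H A x j k := rfl

theorem sum_spectralKernel_mul_star (H : Matrix (Fin n) (Fin n) ℝ)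
    (A : Matrix (Fin n) (Fin n) ℂ) (s t x : ℝ) (j k : Fin n) :
    ∑ l, spectralKernel H A s x j l * star (spectralKernel H A t x k l)
      = intervalKernel s x * star (intervalKernel t x) * spectralDensity H A x j k := by
  simp_rw [spectralKernel_apply, spectralDensity, Matrix.mul_apply, Finset.mul_sum, star_mul',
    Matrix.conjTranspose_apply]
  exact Finset.sum_congr rfl fun l _ ↦ by ring

theorem map_star_mul (M N : Matrix (Fin n) (Fin n) ℂ) :
    (M * N).map star = M.map star * N.map star :=
  Matrix.map_mul (f := starRingEnd ℂ)

theorem map_star_map_ofReal (M : Matrix (Fin n) (Fin n) ℝ) :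
    (M.map Complex.ofReal).map star = M.map Complex.ofReal := by
  ext; simp

theorem conjTranspose_map_ofReal (M : Matrix (Fin n) (Fin n) ℝ) :
    (M.map Complex.ofReal)ᴴ = Mᵀ.map Complex.ofReal := by
  ext; simp

theorem conjTranspose_map_star (M : Matrix (Fin n) (Fin n) ℂ) :
    (M.map star)ᴴ = Mᴴ.map star := rfl

/-- The convention `0 ^ M = 0` removes the `Ā` term on the positive half-line. -/
theorem spectralDensity_of_pos (H : Matrix (Fin n) (Fin n) ℝ) (A : Matrix (Fin n) (Fin n) ℂ)
    {x : ℝ} (hx : 0 < x) :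
    spectralDensity H A x = (opPow x (-(H - (1 / 2 : ℝ) • 1))).map Complex.ofReal * (A * Aᴴ)
      * (opPow x (-(H - (1 / 2 : ℝ) • 1)))ᵀ.map Complex.ofReal := by
  have h₁ : max x 0 = x := max_eq_left hx.le
  have h₂ : max (-x) 0 = 0 := max_eq_right (by linarith)
  have h₃ : ∀ M : Matrix (Fin n) (Fin n) ℝ, (opPow 0 M).map Complex.ofReal = 0 := by
    intro M; ext; simp [opPow]
  simp only [spectralDensity, spectralFactor, h₁, h₂, h₃, Matrix.zero_mul, add_zero,
    Matrix.conjTranspose_mul, conjTranspose_map_ofReal, Matrix.mul_assoc]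

theorem spectralFactor_neg (H : Matrix (Fin n) (Fin n) ℝ) (A : Matrix (Fin n) (Fin n) ℂ)
    (x : ℝ) : spectralFactor H A (-x) = (spectralFactor H A x).map star := by
  have : ∀ M N : Matrix (Fin n) (Fin n) ℂ, (M + N).map star = M.map star + N.map star :=
    fun M N ↦ by ext; simp
  simp only [spectralFactor, neg_neg, this, map_star_mul, map_star_map_ofReal]
  rw [add_comm]
  congr 2
  ext; simp

theorem spectralDensity_neg (H : Matrix (Fin n) (Fin n) ℝ) (A : Matrix (Fin n) (Fin n) ℂ)
    (x : ℝ) : spectralDensity H A (-x) = (spectralDensity H A x).map star := by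
  simp only [spectralDensity, spectralFactor_neg, map_star_mul, conjTranspose_map_star]

theorem spectralDensity_zero (H : Matrix (Fin n) (Fin n) ℝ) (A : Matrix (Fin n) (Fin n) ℂ) :
    spectralDensity H A 0 = 0 := by
  have h₃ : ∀ M : Matrix (Fin n) (Fin n) ℝ, (opPow 0 M).map Complex.ofReal = 0 := by
    intro M; ext; simp [opPow]
  simp [spectralDensity, spectralFactor, h₃]

theorem isUnit_map_opPow {x : ℝ} (hx : x ≠ 0) (M : Matrix (Fin n) (Fin n) ℝ) :
    IsUnit ((opPow x M).map Complex.ofReal) := by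
  have : IsUnit (opPow x M) := by
    rw [opPow, if_neg hx]
    exact Matrix.isUnit_exp _
  exact this.map (Complex.ofRealHom.mapMatrix (m := Fin n))

/-- The outer factors are real and invertible (matrix exponentials), so conjugation acts on `AA*`
alone and both factors cancel. -/
theorem spectralDensity_map_star_iff (H : Matrix (Fin n) (Fin n) ℝ)
    (A : Matrix (Fin n) (Fin n) ℂ) {x : ℝ} (hx : 0 < x) :
    (spectralDensity H A x).map star = spectralDensity H A x ↔ A * Aᴴ = (A * Aᴴ).map star := by
  have hu := isUnit_map_opPow hx.ne' (-(H - (1 / 2 : ℝ) • 1))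
  have hu' : IsUnit ((opPow x (-(H - (1 / 2 : ℝ) • 1)))ᵀ.map Complex.ofReal) := by
    rw [← conjTranspose_map_ofReal]
    exact hu.star
  rw [spectralDensity_of_pos H A hx, map_star_mul, map_star_mul _ (A * Aᴴ), map_star_map_ofReal,
    map_star_map_ofReal, hu'.mul_left_inj, hu.mul_right_inj, eq_comm]

theorem spectralDensity_map_star (H : Matrix (Fin n) (Fin n) ℝ)
    {A : Matrix (Fin n) (Fin n) ℂ} (hA : A * Aᴴ = (A * Aᴴ).map star) (x : ℝ) :
    (spectralDensity H A x).map star = spectralDensity H A x := by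
  rcases lt_trichotomy x 0 with hx | rfl | hx
  · have h := (spectralDensity_map_star_iff H A (neg_pos.2 hx)).2 hA
    rw [spectralDensity_neg] at h
    rw [← h]
    ext; simp
  · rw [spectralDensity_zero]
    ext; simp
  · exact (spectralDensity_map_star_iff H A hx).2 hA

theorem mul_conjTranspose_eq_map_star_iff (A₁ A₂ : Matrix (Fin n) (Fin n) ℝ)
    {A : Matrix (Fin n) (Fin n) ℂ}
    (hA : A = A₁.map Complex.ofReal + Complex.I • A₂.map Complex.ofReal) :
    A * Aᴴ = (A * Aᴴ).map star ↔ A₂ * A₁ᵀ = A₁ * A₂ᵀ := by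
  have him : ∀ j k, ((A * Aᴴ) j k).im = (A₂ * A₁ᵀ) j k - (A₁ * A₂ᵀ) j k := by
    intro j k
    simp only [Matrix.mul_apply, Complex.im_sum, ← Finset.sum_sub_distrib]
    refine Finset.sum_congr rfl fun l _ ↦ ?_
    simp [hA, Matrix.conjTranspose_apply]
    ring
  have hconj : ∀ z : ℂ, z = star z ↔ z.im = 0 := fun z ↦ by
    rw [eq_comm, Complex.star_def, Complex.conj_eq_iff_im]
  simp only [← Matrix.ext_iff, Matrix.map_apply, hconj, him, sub_eq_zero]

/-! ### Covariance of the process and its behaviour under time reversal -/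

section Representation

variable {n : ℕ} {Ω Ω' : Type*} [MeasurableSpace Ω] [MeasurableSpace Ω'] {P : Measure Ω}
  {P' : Measure Ω'} {H : Matrix (Fin n) (Fin n) ℝ} {A : Matrix (Fin n) (Fin n) ℂ}
  {B₁ B₂ : Set ℝ → Ω' → Fin n → ℝ} {X : ℝ → Ω → Fin n → ℝ}

theorem EqFDD.integral_mul_eq {T E : Type*} [MeasurableSpace E] {X : T → Ω → E} {Y : T → Ω' → E}
    (h : EqFDD X Y P P') (s t : T) {F : Type*} [NormedAddCommGroup F] [NormedSpace ℝ F]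
    [MeasurableSpace F] [BorelSpace F] [SecondCountableTopology F] {u : E × E → F}
    (hu : Measurable u) :
    ∫ ω, u (X s ω, X t ω) ∂P = ∫ ω, u (Y s ω, Y t ω) ∂P' := by
  classical
  have hs : s ∈ ({s, t} : Finset T) := by simp
  have ht : t ∈ ({s, t} : Finset T) := by simp
  have hm : Measurable fun x : ({s, t} : Finset T) → E ↦ u (x ⟨s, hs⟩, x ⟨t, ht⟩) := by
    fun_prop
  exact ((h {s, t}).comp hm).integral_eq

theorem HasSpectralRepresentation.integral_eq_zero [IsProbabilityMeasure P']
    (hrep : HasSpectralRepresentation P P' H A B₁ B₂ X) (t : ℝ) (j : Fin n) :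
    ∫ ω, X t ω j ∂P = 0 := by
  obtain ⟨hB, Y, hY, hXY⟩ := hrep
  have := hXY.integral_mul_eq t t (u := fun p : (Fin n → ℂ) × (Fin n → ℂ) ↦ p.1 j) (by fun_prop)
  rw [(hY t).integral_eq_zero hB, integral_complex_ofReal] at this
  exact_mod_cast this

theorem HasSpectralRepresentation.integrable_spectralDensity
    (hrep : HasSpectralRepresentation P P' H A B₁ B₂ X) (s t : ℝ) (j k : Fin n) :
    Integrable fun x ↦
      intervalKernel s x * star (intervalKernel t x) * spectralDensity H A x j k := by
  obtain ⟨-, Y, hY, -⟩ := hrep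
  simp_rw [← sum_spectralKernel_mul_star]
  exact integrable_finsetSum _ fun l _ ↦ ((hY s).1 j l).integrable_mul ((hY t).1 k l).star

/-- The covariance of the process in terms of the spectral density. -/
theorem HasSpectralRepresentation.integral_mul
    (hrep : HasSpectralRepresentation P P' H A B₁ B₂ X) (s t : ℝ) (j k : Fin n) :
    ((∫ ω, X s ω j * X t ω k ∂P : ℝ) : ℂ)
      = ∫ x, intervalKernel s x * star (intervalKernel t x) * spectralDensity H A x j k := by
  obtain ⟨hB, Y, hY, hXY⟩ := hrep
  have h := hXY.integral_mul_eq s t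
    (u := fun p : (Fin n → ℂ) × (Fin n → ℂ) ↦ p.1 j * star (p.2 k)) (by fun_prop)
  simp only [(hY s).integral_mul_star hB (hY t)] at h
  have hi : ∀ l, Integrable fun x ↦ spectralKernel H A s x j l * star (spectralKernel H A t x k l) :=
    fun l ↦ ((hY s).1 j l).integrable_mul ((hY t).1 k l).star
  simp_rw [← sum_spectralKernel_mul_star]
  rw [integral_finsetSum _ fun l _ ↦ hi l, ← h, ← integral_complex_ofReal]
  simp

/-- The left side is real, so the covariance formula at `(-s, -t)` may be conjugated; this undoes
the conjugation of the kernels and moves it onto the density. -/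
theorem HasSpectralRepresentation.integral_neg_mul
    (hrep : HasSpectralRepresentation P P' H A B₁ B₂ X) (s t : ℝ) (j k : Fin n) :
    ((∫ ω, X (-s) ω j * X (-t) ω k ∂P : ℝ) : ℂ)
      = ∫ x, intervalKernel s x * star (intervalKernel t x)
          * star (spectralDensity H A x j k) := by
  rw [← Complex.conj_ofReal, hrep.integral_mul, ← integral_conj]
  refine integral_congr_ae (Eventually.of_forall fun x ↦ ?_)
  simp [intervalKernel_neg]

theorem HasSpectralRepresentation.timeReversible [IsProbabilityMeasure P']
    (hrep : HasSpectralRepresentation P P' H A B₁ B₂ X) (hX : IsGaussianProcess X P)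
    (hA : A * Aᴴ = (A * Aᴴ).map star) : TimeReversible P X := by
  refine eqFDD_of_integral_mul_eq hX (hX.comp_right Neg.neg) hrep.integral_eq_zero
    (fun t ↦ hrep.integral_eq_zero (-t)) fun s t j k ↦ ?_
  have h : ((∫ ω, X s ω j * X t ω k ∂P : ℝ) : ℂ)
      = ((∫ ω, X (-s) ω j * X (-t) ω k ∂P : ℝ) : ℂ) := by
    rw [hrep.integral_mul, hrep.integral_neg_mul]
    refine integral_congr_ae (Eventually.of_forall fun x ↦ ?_)
    have := congrFun (congrFun (spectralDensity_map_star H hA x) j) k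
    simp only [Matrix.map_apply] at this
    simp only [this]
  exact_mod_cast h

/-- Reversibility equates the covariance formulas with `S` and with `S̄`; their difference carries
`S - S̄ = 2i Im S`, entrywise. -/
theorem HasSpectralRepresentation.integral_mul_im_eq_zero
    (hrep : HasSpectralRepresentation P P' H A B₁ B₂ X) (hrev : TimeReversible P X)
    (s t : ℝ) (j k : Fin n) :
    Integrable (fun x ↦ intervalKernel s x * star (intervalKernel t x)
        * ((spectralDensity H A x j k).im : ℂ)) ∧
      ∫ x, intervalKernel s x * star (intervalKernel t x)
        * ((spectralDensity H A x j k).im : ℂ) = 0 := by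
  have him : ∀ x, intervalKernel s x * star (intervalKernel t x)
        * ((spectralDensity H A x j k).im : ℂ)
      = (2 * Complex.I)⁻¹ *
        (intervalKernel s x * star (intervalKernel t x) * spectralDensity H A x j k
          - intervalKernel s x * star (intervalKernel t x)
            * star (spectralDensity H A x j k)) := by
    intro x
    rw [Complex.im_eq_sub_conj, Complex.star_def]
    ring
  have hi := hrep.integrable_spectralDensity s t j k
  have hi' : Integrable fun x ↦ intervalKernel s x * star (intervalKernel t x)
      * star (spectralDensity H A x j k) := by
    refine (Complex.conjCLE.toContinuousLinearMap.integrable_comp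
      (hrep.integrable_spectralDensity (-s) (-t) j k)).congr ?_
    exact Eventually.of_forall fun x ↦ by simp [intervalKernel_neg]
  have hcov := hrev.integral_mul_eq s t
    (u := fun p : (Fin n → ℝ) × (Fin n → ℝ) ↦ p.1 j * p.2 k) (by fun_prop)
  simp_rw [him]
  refine ⟨(hi.sub hi').const_mul _, ?_⟩
  rw [integral_const_mul, integral_sub hi hi', ← hrep.integral_mul, ← hrep.integral_neg_mul, hcov,
    sub_self, mul_zero]

theorem HasSpectralRepresentation.mul_conjTranspose_eq_map_star
    (hrep : HasSpectralRepresentation P P' H A B₁ B₂ X) (hrev : TimeReversible P X) :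
    A * Aᴴ = (A * Aᴴ).map star := by
  -- The weight `|k_1|²` makes the function integrable and real, as Fourier uniqueness needs.
  have hae : ∀ j k, (fun x ↦ Complex.normSq (intervalKernel 1 x)
      * (spectralDensity H A x j k).im) =ᵐ[volume] 0 := by
    intro j k
    have hsq : ∀ x, ((Complex.normSq (intervalKernel 1 x)
        * (spectralDensity H A x j k).im : ℝ) : ℂ)
        = intervalKernel 1 x * star (intervalKernel 1 x)
          * ((spectralDensity H A x j k).im : ℂ) := by
      intro x
      rw [Complex.star_def, Complex.mul_conj, Complex.ofReal_mul]
    refine ae_eq_zero_of_integral_exp_mul_eq_zero ?_ fun h ↦ ?_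
    · refine (hrep.integral_mul_im_eq_zero hrev 1 1 j k).1.re.congr ?_
      refine Eventually.of_forall fun x ↦ ?_
      simp only [← hsq]
      exact Complex.ofReal_re _
    -- Subtracting the identities at `(1 + h, 1)` and `(h, 1)` leaves `e^{ihx} |k_1|² Im S` under
    -- the integral.
    · obtain ⟨hi₁, h₁⟩ := hrep.integral_mul_im_eq_zero hrev (1 + h) 1 j k
      obtain ⟨hi₂, h₂⟩ := hrep.integral_mul_im_eq_zero hrev h 1 j k
      rw [← sub_self (0 : ℂ)]
      nth_rewrite 1 [← h₁]
      rw [← h₂, ← integral_sub hi₁ hi₂]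
      refine integral_congr_ae (Eventually.of_forall fun x ↦ ?_)
      simp only [hsq]
      rw [← mul_assoc, ← mul_assoc, ← intervalKernel_add_sub]
      ring
  have hall : ∀ᵐ x : ℝ, ∀ j k, Complex.normSq (intervalKernel 1 x)
      * (spectralDensity H A x j k).im = 0 :=
    ae_all_iff.2 fun j ↦ ae_all_iff.2 fun k ↦ hae j k
  -- A single point suffices, since `AA*` does not depend on `x`; `(0, 1)` has positive measure and
  -- `k_1` has no zero there.
  have hpos : ∃ᵐ x : ℝ, x ∈ Set.Ioo (0 : ℝ) 1 := by
    rw [frequently_ae_mem_iff]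
    simp
  obtain ⟨x, hx, hzero⟩ := (hpos.and_eventually hall).exists
  rw [← spectralDensity_map_star_iff H A hx.1]
  ext j k
  refine Complex.conj_eq_iff_im.2 ((mul_eq_zero.1 (hzero j k)).resolve_left ?_)
  exact fun h ↦ intervalKernel_one_ne_zero hx.1 hx.2 (Complex.normSq_eq_zero.1 h)

end Representation

end OFBM

theorem theorem5p1 {n : ℕ}
    {Ω : Type*} [MeasurableSpace Ω] (P : Measure Ω) [IsProbabilityMeasure P]
    {Ω' : Type*} [MeasurableSpace Ω'] (P' : Measure Ω') [IsProbabilityMeasure P']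
    (H : Matrix (Fin n) (Fin n) ℝ)
    (A : Matrix (Fin n) (Fin n) ℂ) (A₁ A₂ : Matrix (Fin n) (Fin n) ℝ)
    (hA : A = A₁.map Complex.ofReal + Complex.I • A₂.map Complex.ofReal)
    (X : ℝ → Ω → Fin n → ℝ) (hX : OFBM.IsOFBM P H X)
    (B₁ B₂ : Set ℝ → Ω' → Fin n → ℝ)
    (hrep : OFBM.HasSpectralRepresentation P P' H A B₁ B₂ X) :
    (OFBM.TimeReversible P X ↔ A * Aᴴ = (A * Aᴴ).map star) ∧
    (A * Aᴴ = (A * Aᴴ).map star ↔ A₂ * A₁ᵀ = A₁ * A₂ᵀ) := by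
  exact ⟨⟨hrep.mul_conjTranspose_eq_map_star, hrep.timeReversible hX.gaussian⟩,
    OFBM.mul_conjTranspose_eq_map_star_iff A₁ A₂ hA⟩
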